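/- All $*$-homomorphisms below are between unital $C^*$-algebras and are unital. For classes $\mathcal X,\mathcal Y$ of unital $C^*$-algebras, a unital $C^*$-algebra $\mathcal A$ is called $\mathcal X$-$\mathcal Y$-projective if for all $\mathcal B\in\mathcal X$, $\mathcal M\in\mathcal Y$, every surjective unital $*$-homomorphism $\pi:\mathcal B\to\mathcal M$ and every unital $*$-homomorphism $\phi:\mathcal A\to\mathcal M$, there is a unital $*$-homomorphism $\psi:\mathcal A\to\mathcal B$ with $\pi\circ\psi=\phi$. Let $RR0$ be the class of unital $C^*$-algebras of real rank zero (every self-adjoint element is a norm limit of self-adjoint elements with finite spectrum); let $AW^*$ be the class of unital $C^*$-algebras in which every set of projections has a least upper bound among the projections (ordered by $p\le q\iff pq=p$) and every maximal abelian self-adjoint subalgebra is the $C^*$-algebra generated by its projections; and let $W^*$ be the class of $C^*$-algebras that are $*$-isomorphic to a von Neumann algebra on some Hilbert space. Theorem. Every nonzero separable unital commutative $C^*$-algebra is $RR0$-$AW^*$-projective. In particular, every nonzero separable unital commutative $C^*$-algebra is $W^*$-$W^*$-projective. -/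

import Mathlib

universe u v w

/-- A property of (unital) C⋆-algebras, i.e. a class of unital C⋆-algebras. -/
abbrev CStarClass : Type (u + 1) := ∀ (B : Type u) [CStarAlgebra B], Prop

/-- A unital C⋆-algebra `A` is `𝒳`-`𝒴` projective if every unital ⋆-homomorphism `φ : A → M`
with `M` in `𝒴` lifts along every surjective unital ⋆-homomorphism `π : B → M`
with `B` in `𝒳` to a unital ⋆-homomorphism `ψ : A → B`. -/
def IsCStarProjective (𝒳 : CStarClass.{v}) (𝒴 : CStarClass.{w})
    (A : Type u) [CStarAlgebra A] : Prop :=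
  ∀ (B : Type v) [CStarAlgebra B] (M : Type w) [CStarAlgebra M], 𝒳 B → 𝒴 M →
    ∀ π : B →⋆ₐ[ℂ] M, Function.Surjective π →
      ∀ φ : A →⋆ₐ[ℂ] M, ∃ ψ : A →⋆ₐ[ℂ] B, π.comp ψ = φ

/-- Real rank zero: every self-adjoint element is a norm limit of self-adjoint elements
with finite spectrum. -/
def HasRealRankZero (B : Type u) [CStarAlgebra B] : Prop :=
  ∀ a : B, IsSelfAdjoint a → ∀ ε : ℝ, 0 < ε →
    ∃ b : B, IsSelfAdjoint b ∧ (spectrum ℂ b).Finite ∧ ‖a - b‖ < ε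

/-- `q` is the least upper bound of `S` among the projections of `M`, ordered by
`p ≤ q ↔ p * q = p`. -/
def IsProjectionLUB {M : Type u} [CStarAlgebra M] (S : Set M) (q : M) : Prop :=
  IsStarProjection q ∧ (∀ p ∈ S, p * q = p) ∧
    ∀ r : M, IsStarProjection r → (∀ p ∈ S, p * r = p) → q * r = q

/-- A maximal abelian self-adjoint subalgebra. -/
def IsMaximalAbelian {M : Type u} [CStarAlgebra M] (C : StarSubalgebra ℂ M) : Prop :=
  Maximal (fun D : StarSubalgebra ℂ M => ∀ x ∈ D, ∀ y ∈ D, x * y = y * x) C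

/-- An AW⋆-algebra: every set of projections has a least upper bound, and every maximal abelian
self-adjoint subalgebra is the C⋆-algebra generated by its projections. -/
def IsAWStarAlgebra (M : Type u) [CStarAlgebra M] : Prop :=
  (∀ S : Set M, (∀ p ∈ S, IsStarProjection p) → ∃ q : M, IsProjectionLUB S q) ∧
    ∀ C : StarSubalgebra ℂ M, IsMaximalAbelian C →
      (StarAlgebra.adjoin ℂ {p : M | p ∈ C ∧ IsStarProjection p}).topologicalClosure = C

/-- A C⋆-algebra is a von Neumann algebra (W⋆-algebra) if it is ⋆-isomorphic to a ⋆-subalgebra of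
the bounded operators on some Hilbert space that equals its double commutant. -/
def IsVonNeumannAlgebra (M : Type u) [CStarAlgebra M] : Prop :=
  ∃ (H : Type u) (_ : NormedAddCommGroup H) (_ : InnerProductSpace ℂ H) (_ : CompleteSpace H)
    (S : VonNeumannAlgebra H), Nonempty (M ≃⋆ₐ[ℂ] S.toStarSubalgebra)

/-! The image of `φ` is commutative, so it lies in a maximal abelian subalgebra of `M`, which is
generated by its projections. By separability, countably many projections `p n` suffice. The element
`x = ∑ 3⁻ⁿ p n` has spectrum in a Cantor set, and each `p n` is a continuous function of `x` (read
off the `n`-th digit). Hence `φ` takes values in the C⋆-algebra generated by `x`, and it is enough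
to lift `x` to a self-adjoint `z` with no additional spectrum: then `f(x) ↦ f(z)` is a
⋆-homomorphism lifting the inclusion.

Real rank zero provides `z`. Any self-adjoint lift of `x` can be perturbed slightly, within the
lifts, so that its spectrum avoids a given real point outside the spectrum of `x`. Baire's theorem
avoids a countable dense set of such points at once. The spectrum of the resulting lift then
retracts continuously onto that of `x`, and applying the retraction gives `z`.

The second claim follows because von Neumann algebras are AW⋆ (joins and range projections) and
AW⋆-algebras have real rank zero. -/

open Filter Topology Set
open scoped CStarAlgebra

/-! ### Self-adjoint lifts with controlled spectrum -/

/-- In a C⋆-algebra of real rank zero, a self-adjoint element whose image under a ⋆-homomorphism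
is invertible can be perturbed, without changing its image, to an invertible one. -/
theorem HasRealRankZero.exists_isUnit_near {B : Type*} [CStarAlgebra B] (hB : HasRealRankZero B)
    {M : Type*} [CStarAlgebra M] [Nontrivial M] (π : B →⋆ₐ[ℂ] M) {y : B} (hy : IsSelfAdjoint y)
    (hu : IsUnit (π y)) {η : ℝ} (hη : 0 < η) :
    ∃ y' : B, IsSelfAdjoint y' ∧ π y' = π y ∧ ‖y' - y‖ < η ∧ IsUnit y' := by
  have : Nontrivial B := RingHom.domain_nontrivial (π : B →+* M)
  obtain ⟨ρ, hρ, hball⟩ := Metric.isOpen_iff.1 (Units.isOpen (R := M)) (π y) hu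
  set ε := ρ / 4 with hε
  have hε0 : 0 < ε := by positivity
  set δ := min ε (η / 2) with hδ
  have hδ0 : 0 < δ := by positivity
  obtain ⟨b₀, hb₀, hfin₀, hyb₀⟩ := hB y hy (δ / 2) (by positivity)
  have hfin₁ : (spectrum ℝ b₀).Finite := by
    rw [← spectrum.preimage_algebraMap ℂ]
    exact hfin₀.preimage (RCLike.ofReal_injective (K := ℂ)).injOn
  -- A small generic shift moves the finite spectrum of `b₀` off `0`.
  obtain ⟨c, ⟨hc0, hcδ⟩, hc⟩ : ∃ c ∈ Ioo (0 : ℝ) (δ / 2), -c ∉ spectrum ℝ b₀ := by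
    by_contra! h
    exact (Ioo_infinite (half_pos hδ0)) ((hfin₁.preimage neg_injective.injOn).subset h)
  set b := b₀ + algebraMap ℝ B c with hbdef
  have hb : IsSelfAdjoint b := hb₀.add (.algebraMap B (.all c))
  have hspec : spectrum ℝ b = (fun s => s + c) '' spectrum ℝ b₀ := by
    rw [hbdef, ← spectrum.add_singleton_eq]; simp
  have hfin : (spectrum ℝ b).Finite := hspec ▸ hfin₁.image _
  have hbu : IsUnit b := by
    rw [← spectrum.zero_notMem_iff ℝ, hspec]
    rintro ⟨s, hs, h⟩
    exact hc (by rwa [← eq_neg_of_add_eq_zero_left h])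
  have hyb : ‖y - b‖ < δ := by
    have : y - b = (y - b₀) - algebraMap ℝ B c := by rw [hbdef]; abel
    rw [this]
    refine (norm_sub_le _ _).trans_lt ?_
    rw [norm_algebraMap', Real.norm_of_nonneg hc0.le]
    linarith
  -- `π b - s` is within `δ + 2ε ≤ 3ε < ρ` of `π y`, hence invertible.
  have hπ : ∀ s ∈ spectrum ℝ (π b), ¬ |s| < 2 * ε := by
    intro s hs hlt
    refine spectrum.mem_iff.1 hs ?_
    rw [IsUnit.sub_iff]
    apply hball
    rw [Metric.mem_ball, dist_eq_norm]
    have : π b - algebraMap ℝ M s - π y = - (π (y - b)) - algebraMap ℝ M s := by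
      rw [map_sub]; abel
    rw [this]
    refine (norm_sub_le _ _).trans_lt ?_
    rw [norm_neg, norm_algebraMap', Real.norm_eq_abs]
    have := NonUnitalStarAlgHom.norm_apply_le π (y - b)
    have := min_le_left ε (η / 2)
    linarith
  -- `f(b)` is the spectral projection of `b` for `|s| ≥ 2ε`, and `g(b)` inverts `b` on its range;
  -- finite spectrum makes both functions continuous there.
  set f : ℝ → ℝ := fun s => if |s| < 2 * ε then 0 else 1 with hf
  set g : ℝ → ℝ := fun s => if |s| < 2 * ε then 0 else s⁻¹ with hg
  have hfc : ContinuousOn f (spectrum ℝ b) := hfin.continuousOn f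
  have hgc : ContinuousOn g (spectrum ℝ b) := hfin.continuousOn g
  have hbg : b * cfc g b = cfc f b := by
    nth_rewrite 1 [← cfc_id' ℝ b]
    rw [← cfc_mul _ _ b]
    refine cfc_congr fun s _ => ?_
    simp only [hf, hg]
    split_ifs with h
    · simp
    · rw [mul_inv_cancel₀]
      rintro rfl
      exact h (by simpa using hε0)
  have hng : ‖cfc g b‖ ≤ (2 * ε)⁻¹ := by
    refine norm_cfc_le (by positivity) fun s _ => ?_
    simp only [hg]
    split_ifs with h
    · simpa using hε0.le
    · rw [norm_inv, Real.norm_eq_abs]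
      gcongr
      exact not_lt.1 h
  have hnf : ‖cfc f b‖ ≤ 1 := by
    refine norm_cfc_le zero_le_one fun s _ => ?_
    simp only [hf]
    split_ifs <;> simp
  have hπf : π (cfc f b) = 1 := by
    rw [StarAlgHomClass.map_cfc π f b hfc (map_continuous π) hb (hb.map π),
      ← cfc_one ℝ (π b) (hb.map π)]
    exact cfc_congr fun s hs => if_neg (hπ s hs)
  set e := cfc f b
  have he : IsSelfAdjoint e := cfc_predicate f b
  have hnorm : ‖e * (y - b) * e‖ ≤ ‖y - b‖ :=
    calc ‖e * (y - b) * e‖ ≤ ‖e‖ * ‖y - b‖ * ‖e‖ := norm_mul₃_le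
      _ ≤ 1 * ‖y - b‖ * 1 := by gcongr
      _ = ‖y - b‖ := by ring
  -- Since `π e = 1`, correcting `b` only in the corner cut out by `e` restores the image `π y`.
  -- There `b` has inverse of norm at most `(2ε)⁻¹`, while the correction is smaller than `ε`, so
  -- invertibility survives.
  refine ⟨b + e * (y - b) * e, hb.add ?_, ?_, ?_, ?_⟩
  · simpa [he.star_eq] using (hy.sub hb).conjugate e
  · simp [hπf]
  · have : b + e * (y - b) * e - y = e * (y - b) * e - (y - b) := by abel
    rw [this]
    have := norm_sub_le (e * (y - b) * e) (y - b)
    have := min_le_right ε (η / 2)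
    linarith
  · have : b + e * (y - b) * e = b * (1 - -(cfc g b * (y - b) * e)) := by
      rw [sub_neg_eq_add, mul_add, mul_one, ← mul_assoc, ← mul_assoc, hbg]
    rw [this]
    refine hbu.mul (isUnit_one_sub_of_norm_lt_one ?_)
    rw [norm_neg]
    calc ‖cfc g b * (y - b) * e‖ ≤ ‖cfc g b‖ * ‖y - b‖ * ‖e‖ := norm_mul₃_le
      _ ≤ (2 * ε)⁻¹ * δ * 1 := by gcongr
      _ ≤ (2 * ε)⁻¹ * ε * 1 := by gcongr; exact min_le_left _ _
      _ < 1 := by field_simp; norm_num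

/-- A self-adjoint element of a quotient of a real rank zero algebra has a self-adjoint lift
whose spectrum avoids a given sequence of real points outside its spectrum. -/
theorem HasRealRankZero.exists_lift_notMem_spectrum {B : Type*} [CStarAlgebra B]
    (hB : HasRealRankZero B) {M : Type*} [CStarAlgebra M] [Nontrivial M] (π : B →⋆ₐ[ℂ] M)
    (hπ : Function.Surjective π) {x : M} (hx : IsSelfAdjoint x) (d : ℕ → ℝ)
    (hd : ∀ n, d n ∉ spectrum ℝ x) :
    ∃ y : B, IsSelfAdjoint y ∧ π y = x ∧ ∀ n, d n ∉ spectrum ℝ y := by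
  have hπc : Continuous π := map_continuous π
  let S : Set B := {y | IsSelfAdjoint y ∧ π y = x}
  have hS : IsClosed S :=
    (isClosed_eq continuous_star continuous_id).inter (isClosed_eq hπc continuous_const)
  have : CompleteSpace S := hS.completeSpace_coe
  have : Nonempty S := by
    obtain ⟨y, hy⟩ := hπ x
    refine ⟨⟨(realPart y : B), (realPart y).2, ?_⟩⟩
    rw [realPart_apply_coe, ← Complex.coe_smul, map_smul, map_add, map_star, hy, hx.star_eq,
      Complex.coe_smul, ← two_smul ℝ x, smul_smul]
    norm_num
  let U : ℕ → Set S := fun n => {y | IsUnit ((y : B) - algebraMap ℝ B (d n))}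
  have hUo : ∀ n, IsOpen (U n) := fun n =>
    Units.isOpen.preimage (continuous_subtype_val.sub continuous_const)
  have hUd : ∀ n, Dense (U n) := by
    intro n
    rw [Metric.dense_iff]
    rintro ⟨y, hy, hyx⟩ η hη
    have hsa : IsSelfAdjoint (algebraMap ℝ B (d n)) := .algebraMap B (.all _)
    have hal : π (algebraMap ℝ B (d n)) = algebraMap ℝ M (d n) :=
      AlgHomClass.commutes (π.restrictScalars ℝ) (d n)
    obtain ⟨y', h1, h2, h3, h4⟩ := hB.exists_isUnit_near π (y := y - algebraMap ℝ B (d n))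
      (hy.sub hsa) (by
        rw [map_sub, hal, hyx, IsUnit.sub_iff]
        exact spectrum.notMem_iff.1 (hd n)) hη
    refine ⟨⟨y' + algebraMap ℝ B (d n), h1.add hsa, ?_⟩, ?_, ?_⟩
    · rw [map_add, h2, map_sub, sub_add_cancel, hyx]
    · rw [Metric.mem_ball, Subtype.dist_eq, dist_eq_norm]
      simpa [sub_sub_eq_add_sub] using h3
    · simpa [U] using h4
  -- Baire category in the complete space of self-adjoint lifts.
  obtain ⟨y, hy⟩ := (dense_iInter_of_isOpen hUo hUd).nonempty
  refine ⟨y, y.2.1, y.2.2, fun n => spectrum.notMem_iff.2 ?_⟩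
  rw [IsUnit.sub_iff]
  exact mem_iInter.1 hy n

/-- A compact set of reals avoiding a dense sequence retracts onto each of its nonempty closed
subsets. -/
theorem IsCompact.exists_retraction_of_denseRange_notMem {K L : Set ℝ} (hL : IsCompact L)
    (hK : IsClosed K) (hKne : K.Nonempty) (hKL : K ⊆ L) {d : ℕ → ℝ} (hd : DenseRange d)
    (hdL : ∀ n, d n ∉ L) :
    ∃ r : ℝ → ℝ, ContinuousOn r L ∧ MapsTo r L K ∧ EqOn r id K := by
  have : CompactSpace L := isCompact_iff_compactSpace.1 hL
  -- Comparison with the points `d n` embeds `L` in Cantor space: the cuts are clopen as `d n ∉ L`,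
  -- and separate points by density. Nonempty closed subsets of Cantor space are retracts.
  let ι : L → ℕ → Bool := fun s n => decide ((s : ℝ) < d n)
  have hι : Continuous ι := by
    refine continuous_pi fun n => IsLocallyConstant.continuous ?_
    have hclopen : IsClopen {s : L | (s : ℝ) < d n} := by
      refine ⟨?_, isOpen_lt continuous_subtype_val continuous_const⟩
      have : {s : L | (s : ℝ) < d n} = {s : L | (s : ℝ) ≤ d n} := by
        ext s
        exact ⟨fun h => (mem_ofPred.1 h).le,
          fun h => lt_of_le_of_ne h fun (h' : (s : ℝ) = d n) => hdL n (h' ▸ s.2)⟩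
      rw [this]
      exact isClosed_le continuous_subtype_val continuous_const
    rw [IsLocallyConstant.iff_isOpen_fiber]
    rintro (_ | _)
    · convert hclopen.compl.isOpen using 1
      ext s; simp [ι]
    · convert hclopen.isOpen using 1
      ext s; simp [ι]
  have hinj : Function.Injective ι := by
    intro s t hst
    by_contra hne
    wlog hlt : (s : ℝ) < t generalizing s t
    · exact this hst.symm (Ne.symm hne)
        (lt_of_le_of_ne (not_lt.1 hlt) fun h => hne (Subtype.ext h.symm))
    obtain ⟨n, hn1, hn2⟩ := hd.exists_mem_open isOpen_Ioo (nonempty_Ioo.2 hlt)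
    have := congrFun hst n
    simp only [ι, hn1, decide_true] at this
    exact lt_asymm (of_decide_eq_true this.symm) hn2
  have hemb : IsClosedEmbedding ι := hι.isClosedEmbedding hinj
  let K' : Set L := (↑) ⁻¹' K
  obtain ⟨f, hf1, hf2, hf3⟩ := PiNat.exists_retraction_of_isClosed (s := ι '' K')
    (hemb.isClosedMap _ (hK.preimage continuous_subtype_val))
    (by obtain ⟨k, hk⟩ := hKne; exact ⟨_, ⟨k, hKL hk⟩, hk, rfl⟩)
  have hmem : ∀ s : L, ∃ k ∈ K', ι k = f (ι s) := fun s => by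
    have : f (ι s) ∈ range f := mem_range_self _
    rwa [hf2] at this
  choose ρ hρK hρ using hmem
  have hρc : Continuous ρ := by
    rw [hemb.isInducing.continuous_iff]
    have : ι ∘ ρ = f ∘ ι := funext hρ
    rw [this]
    exact hf3.comp hι
  classical
  refine ⟨fun s => if h : s ∈ L then ρ ⟨s, h⟩ else 0, ?_, ?_, ?_⟩
  · rw [continuousOn_iff_continuous_domRestrict]
    convert continuous_subtype_val.comp hρc using 1
    ext s; simp
  · intro s hs
    simp only [hs, dite_true]
    exact hρK ⟨s, hs⟩
  · intro s hs
    have : ρ ⟨s, hKL hs⟩ = ⟨s, hKL hs⟩ :=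
      hinj ((hρ _).trans (hf1 _ ⟨⟨s, hKL hs⟩, hs, rfl⟩))
    simp [hKL hs, this]

/-- A self-adjoint element with totally disconnected spectrum in a quotient of a real rank zero
algebra has a self-adjoint lift without additional spectrum. -/
theorem HasRealRankZero.exists_lift_spectrum_subset {B : Type*} [CStarAlgebra B]
    (hB : HasRealRankZero B) {M : Type*} [CStarAlgebra M] [Nontrivial M] (π : B →⋆ₐ[ℂ] M)
    (hπ : Function.Surjective π) {x : M} (hx : IsSelfAdjoint x)
    (hint : interior (spectrum ℝ x) = ∅) :
    ∃ z : B, IsSelfAdjoint z ∧ π z = x ∧ spectrum ℝ z ⊆ spectrum ℝ x := by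
  obtain ⟨D, hDsub, hDc, hDd⟩ :=
    (interior_eq_empty_iff_dense_compl.1 hint).exists_countable_dense_subset
  obtain ⟨d, rfl⟩ := hDc.exists_eq_range hDd.nonempty
  obtain ⟨y, hy, hyx, hyd⟩ := hB.exists_lift_notMem_spectrum π hπ hx d
    fun n => hDsub (mem_range_self n)
  have hsub : spectrum ℝ x ⊆ spectrum ℝ y :=
    hyx ▸ AlgHom.spectrum_apply_subset (π.toAlgHom.restrictScalars ℝ) y
  obtain ⟨r, hr, hrm, hre⟩ := (ContinuousFunctionalCalculus.isCompact_spectrum (R := ℝ)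
    y).exists_retraction_of_denseRange_notMem (spectrum.isClosed x)
      (ContinuousFunctionalCalculus.spectrum_nonempty x hx) hsub hDd hyd
  refine ⟨cfc r y, cfc_predicate r y, ?_, ?_⟩
  · rw [StarAlgHomClass.map_cfc π r y hr (map_continuous π) hy (hy.map π), hyx,
      cfc_congr hre, cfc_id ℝ x]
  · rw [cfc_map_spectrum r y]
    exact hrm.image_subset

/-! ### Cantor sets and countable families of projections -/

theorem Cardinal.continuous_cantorFunction {c : ℝ} (h1 : 0 ≤ c) (h2 : c < 1) :
    Continuous (Cardinal.cantorFunction c) := by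
  refine continuous_tsum (fun n => ?_) (summable_geometric_of_lt_one h1 h2) fun n f => ?_
  · exact (continuous_of_discreteTopology (f := fun b : Bool => cond b (c ^ n) 0)).comp
      (continuous_apply n)
  · rcases h : f n <;> simp [h, h1, abs_of_nonneg]

theorem Cardinal.isClosedEmbedding_cantorFunction {c : ℝ} (h1 : 0 < c) (h2 : c < 1 / 2) :
    IsClosedEmbedding (Cardinal.cantorFunction c) :=
  (continuous_cantorFunction h1.le (by linarith)).isClosedEmbedding
    (cantorFunction_injective h1 h2)

theorem IsTotallyDisconnected.interior_eq_empty {s : Set ℝ} (hs : IsTotallyDisconnected s) :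
    interior s = ∅ := by
  refine eq_empty_of_forall_notMem fun x hx => ?_
  obtain ⟨ε, hε, hball⟩ := Metric.isOpen_iff.1 isOpen_interior x hx
  have hsub := hs _ (hball.trans interior_subset) (convex_ball x ε).isPreconnected
  have hmem : x + ε / 2 ∈ Metric.ball x ε := by
    rw [Metric.mem_ball, dist_eq_norm, add_sub_cancel_left, Real.norm_of_nonneg (by positivity)]
    linarith
  have := hsub (Metric.mem_ball_self hε) hmem
  linarith

theorem IsIdempotentElem.eq_zero_or_one_apply {N : Type*} [CommCStarAlgebra N] {p : N}
    (hp : IsIdempotentElem p) (χ : WeakDual.characterSpace ℂ N) : χ p = 0 ∨ χ p = 1 :=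
  IsIdempotentElem.iff_eq_zero_or_one.1 (hp.map χ)

/-- Countably many projections in a commutative C⋆-algebra lie in the C⋆-algebra generated by a
single self-adjoint element with spectrum in a Cantor set. -/
theorem CommCStarAlgebra.exists_isSelfAdjoint_forall_mem_elemental {N : Type*}
    [CommCStarAlgebra N] (p : ℕ → N) (hp : ∀ n, IsStarProjection (p n)) :
    ∃ x : N, IsSelfAdjoint x ∧ interior (spectrum ℝ x) = ∅ ∧
      ∀ n, p n ∈ StarAlgebra.elemental ℂ x := by
  classical
  -- Any ratio below `1 / 2` makes the digits recoverable from the sum.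
  set F := Cardinal.cantorFunction (1 / 3) with hFdef
  have hF : IsClosedEmbedding F :=
    Cardinal.isClosedEmbedding_cantorFunction (by norm_num) (by norm_num)
  have hsum : Summable fun n => ((1 / 3 : ℝ) ^ n) • p n := by
    refine .of_norm_bounded (summable_geometric_of_lt_one (r := (1 / 3 : ℝ)) (by norm_num)
      (by norm_num)) fun n => ?_
    rw [norm_smul, Real.norm_of_nonneg (by positivity)]
    exact mul_le_of_le_one_right (by positivity) (hp n).norm_le
  set x := ∑' n, ((1 / 3 : ℝ) ^ n) • p n with hxdef
  have hx : IsSelfAdjoint x := by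
    rw [IsSelfAdjoint, hxdef, tsum_star]
    simp [(hp _).isSelfAdjoint.star_eq]
  let bits : WeakDual.characterSpace ℂ N → ℕ → Bool := fun χ n => decide (χ (p n) = 1)
  have hχ : ∀ χ : WeakDual.characterSpace ℂ N, χ x = (F (bits χ) : ℂ) := by
    intro χ
    rw [hxdef, hsum.map_tsum χ (map_continuous χ), hFdef, Cardinal.cantorFunction,
      Complex.ofReal_tsum]
    refine tsum_congr fun n => ?_
    rw [← Complex.coe_smul, map_smul]
    rcases (hp n).isIdempotentElem.eq_zero_or_one_apply χ with h | h
    · rw [Cardinal.cantorFunctionAux_false (by simp [bits, h]), h]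
      simp
    · rw [Cardinal.cantorFunctionAux_true (by simp [bits, h]), h]
      simp
  have hspec : spectrum ℝ x ⊆ range F := by
    intro s hs
    rw [← spectrum.preimage_algebraMap ℂ] at hs
    obtain ⟨χ, h⟩ := WeakDual.CharacterSpace.mem_spectrum_iff_exists.1 hs
    rw [hχ] at h
    exact ⟨bits χ, Complex.ofReal_injective h⟩
  refine ⟨x, hx, ?_, fun n => ?_⟩
  · exact subset_eq_empty (interior_mono hspec)
      (hF.isEmbedding.isTotallyDisconnected_range.2 inferInstance).interior_eq_empty
  · let g : ℝ → ℝ := fun s => if Function.invFun F s n = true then 1 else 0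
    have hgF : ∀ f : ℕ → Bool, g (F f) = if f n = true then 1 else 0 := fun f => by
      simp only [g, Function.leftInverse_invFun hF.injective f]
    have hg : ContinuousOn g (range F) := by
      rw [continuousOn_iff_continuous_domRestrict,
        ← hF.isEmbedding.toHomeomorph.comp_continuous_iff']
      have : (range F).domRestrict g ∘ hF.isEmbedding.toHomeomorph =
          (fun b : Bool => if b = true then (1 : ℝ) else 0) ∘ fun f : ℕ → Bool => f n :=
        funext hgF
      rw [this]
      exact continuous_of_discreteTopology.comp (continuous_apply n)
    have : p n = cfc g x := by
      refine (gelfandStarTransform N).injective (ContinuousMap.ext fun χ => ?_)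
      change χ (p n) = χ (cfc g x)
      rw [StarAlgHomClass.map_cfc χ g x (hg.mono hspec) (map_continuous χ) hx (hx.map χ), hχ,
        ← Complex.coe_algebraMap, cfc_algebraMap, hgF]
      rcases (hp n).isIdempotentElem.eq_zero_or_one_apply χ with h | h <;> simp [bits, h]
    rw [this]
    have := StarAlgebra.elemental.isClosed ℂ x
    exact cfc_mem (𝕜' := ℂ) g (StarAlgebra.elemental.self_mem ℂ x)

/-! ### Maximal abelian subalgebras and countable generation -/

section MaximalAbelian

variable {M : Type*} [CStarAlgebra M]

theorem StarSubalgebra.exists_isMaximalAbelian_ge (D : StarSubalgebra ℂ M)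
    (hD : ∀ x ∈ D, ∀ y ∈ D, x * y = y * x) :
    ∃ C : StarSubalgebra ℂ M, D ≤ C ∧ IsMaximalAbelian C := by
  refine zorn_le_nonempty₀ {D : StarSubalgebra ℂ M | ∀ x ∈ D, ∀ y ∈ D, x * y = y * x}
    (fun c hc hchain E hE => ?_) D hD
  have : Nonempty c := ⟨⟨E, hE⟩⟩
  have hmem : ∀ x, x ∈ (⨆ S : c, (S : StarSubalgebra ℂ M)) ↔
      ∃ S : c, x ∈ (S : StarSubalgebra ℂ M) :=
    fun x => by
      rw [← SetLike.mem_coe, StarSubalgebra.coe_iSup_of_directed hchain.directed, mem_iUnion]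
      rfl
  refine ⟨⨆ S : c, (S : StarSubalgebra ℂ M), fun x hx y hy => ?_,
    fun S hS => le_iSup (fun S : c => (S : StarSubalgebra ℂ M)) ⟨S, hS⟩⟩
  obtain ⟨S, hxS⟩ := (hmem x).1 hx
  obtain ⟨T, hyT⟩ := (hmem y).1 hy
  rcases hchain.total S.2 T.2 with h | h
  · exact hc T.2 x (h hxS) y hyT
  · exact hc S.2 x hxS y (h hyT)

namespace IsMaximalAbelian

variable {C : StarSubalgebra ℂ M}

theorem isClosed (hC : IsMaximalAbelian C) : IsClosed (C : Set M) := by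
  have h : C.topologicalClosure ≤ C := by
    refine hC.2 ?_ C.le_topologicalClosure
    let := C.commRingTopologicalClosure fun x y => Subtype.ext (hC.1 x x.2 y y.2)
    exact fun x hx y hy => congrArg Subtype.val
      (mul_comm (⟨x, hx⟩ : C.topologicalClosure) ⟨y, hy⟩)
  exact (le_antisymm C.le_topologicalClosure h) ▸ C.isClosed_topologicalClosure

/-- Adjoining `e` to `C` gives a commutative ⋆-subalgebra, which maximality forces back into `C`. -/
theorem mem_of_commute (hC : IsMaximalAbelian C) {e : M} (he : IsSelfAdjoint e)
    (hcomm : ∀ x ∈ C, x * e = e * x) : e ∈ C := by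
  have hs : ∀ x ∈ insert e (C : Set M), ∀ y ∈ insert e (C : Set M), x * y = y * x := by
    rintro x (rfl | hx) y (rfl | hy)
    · rfl
    · exact (hcomm y hy).symm
    · exact hcomm x hx
    · exact hC.1 x hx y hy
  have hstar : ∀ y ∈ insert e (C : Set M), star y ∈ insert e (C : Set M) := by
    rintro y (rfl | hy)
    · exact Or.inl he
    · exact Or.inr (star_mem hy)
  have := StarAlgebra.isMulCommutative_adjoin ℂ hs fun x hx y hy => hs x hx _ (hstar y hy)
  exact hC.2 (fun x hx y hy => setLike_mul_comm hx hy)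
    (fun x hx => StarAlgebra.subset_adjoin ℂ _ (mem_insert_of_mem e hx))
    (StarAlgebra.subset_adjoin ℂ _ (mem_insert e C))

/-- A maximal abelian self-adjoint subalgebra is a commutative C⋆-algebra. -/
noncomputable abbrev commCStarAlgebra (hC : IsMaximalAbelian C) : CommCStarAlgebra C :=
  { StarSubalgebra.cstarAlgebra C (h_closed := hC.isClosed) with
    mul_comm := fun x y => Subtype.ext (hC.1 x x.2 y y.2) }

end IsMaximalAbelian

theorem exists_countable_subset_mem_adjoin {P : Set M} {z : M} (hz : z ∈ StarAlgebra.adjoin ℂ P) :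
    ∃ T ⊆ P, T.Countable ∧ z ∈ StarAlgebra.adjoin ℂ T := by
  induction hz using StarAlgebra.adjoin_induction with
  | mem x hx => exact ⟨{x}, singleton_subset_iff.2 hx, countable_singleton x,
      StarAlgebra.subset_adjoin ℂ _ rfl⟩
  | algebraMap r => exact ⟨∅, empty_subset _, countable_empty, algebraMap_mem _ r⟩
  | add x y _ _ hx hy =>
    obtain ⟨T, hT, hTc, hxT⟩ := hx
    obtain ⟨U, hU, hUc, hyU⟩ := hy
    exact ⟨T ∪ U, union_subset hT hU, hTc.union hUc,
      add_mem (StarAlgebra.adjoin_mono subset_union_left hxT)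
        (StarAlgebra.adjoin_mono subset_union_right hyU)⟩
  | mul x y _ _ hx hy =>
    obtain ⟨T, hT, hTc, hxT⟩ := hx
    obtain ⟨U, hU, hUc, hyU⟩ := hy
    exact ⟨T ∪ U, union_subset hT hU, hTc.union hUc,
      mul_mem (StarAlgebra.adjoin_mono subset_union_left hxT)
        (StarAlgebra.adjoin_mono subset_union_right hyU)⟩
  | star x _ hx =>
    obtain ⟨T, hT, hTc, hxT⟩ := hx
    exact ⟨T, hT, hTc, star_mem hxT⟩

/-- A separable family in the C⋆-algebra generated by a set lies in the C⋆-algebra generated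
by a countable subset. -/
theorem exists_countable_forall_mem_topologicalClosure_adjoin {A : Type*} [TopologicalSpace A]
    [TopologicalSpace.SeparableSpace A] {f : A → M} (hf : Continuous f) {P : Set M}
    (hP : ∀ a, f a ∈ (StarAlgebra.adjoin ℂ P).topologicalClosure) :
    ∃ T ⊆ P, T.Countable ∧ ∀ a, f a ∈ (StarAlgebra.adjoin ℂ T).topologicalClosure := by
  obtain ⟨s, hsc, hsd⟩ := TopologicalSpace.exists_countable_dense A
  have : Countable s := hsc.to_subtype
  have hseq : ∀ a : s, ∃ u : ℕ → M, (∀ n, u n ∈ StarAlgebra.adjoin ℂ P) ∧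
      Tendsto u atTop (𝓝 (f a)) := fun a => mem_closure_iff_seq_limit.1 (hP a)
  choose u hu hlim using hseq
  choose T hTP hTc hT using fun (a : s) (n : ℕ) => exists_countable_subset_mem_adjoin (hu a n)
  refine ⟨⋃ a, ⋃ n, T a n, iUnion_subset fun a => iUnion_subset (hTP a),
    countable_iUnion fun a => countable_iUnion (hTc a), fun a => ?_⟩
  refine closure_minimal (t := f ⁻¹' closure _) (fun b hb => ?_)
    (isClosed_closure.preimage hf) (hsd a)
  exact mem_closure_of_tendsto (hlim ⟨b, hb⟩) (.of_forall fun n =>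
    StarAlgebra.adjoin_mono (fun _ hx =>
      mem_iUnion.2 ⟨⟨b, hb⟩, mem_iUnion.2 ⟨n, hx⟩⟩) (hT ⟨b, hb⟩ n))

end MaximalAbelian

/-! ### Lifting homomorphisms by functional calculus -/

/-- A ⋆-homomorphism into the C⋆-algebra generated by a normal element `π z` lifts along `π` when
`z` is normal and has no more spectrum than `π z`. -/
theorem StarAlgHom.exists_lift_of_forall_mem_elemental {A B M : Type*} [CStarAlgebra A]
    [CStarAlgebra B] [CStarAlgebra M] (π : B →⋆ₐ[ℂ] M) (φ : A →⋆ₐ[ℂ] M) {z : B}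
    (hz : IsStarNormal z) (hspec : spectrum ℂ z ⊆ spectrum ℂ (π z))
    (hφ : ∀ a, φ a ∈ StarAlgebra.elemental ℂ (π z)) :
    ∃ ψ : A →⋆ₐ[ℂ] B, π.comp ψ = φ := by
  have hx : IsStarNormal (π z) := hz.map π
  let incl : C(spectrum ℂ z, spectrum ℂ (π z)) := ⟨inclusion hspec, continuous_inclusion hspec⟩
  let θ : C(spectrum ℂ (π z), ℂ) →⋆ₐ[ℂ] B :=
    (cfcHom hz).comp (ContinuousMap.compStarAlgHom' ℂ ℂ incl)
  -- Both sides are continuous and send the identity function to `π z`, so uniqueness of the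
  -- functional calculus applies.
  have hθ : cfcHom hx = π.comp θ := by
    refine cfcHom_eq_of_continuous_of_map_id hx _ (map_continuous _) ?_
    exact congrArg π (cfcHom_id hz)
  let e := continuousFunctionalCalculus (π z)
  refine ⟨θ.comp ((e.symm : _ →⋆ₐ[ℂ] _).comp (φ.codRestrict _ hφ)), StarAlgHom.ext fun a => ?_⟩
  change (π.comp θ) (e.symm (φ.codRestrict _ hφ a)) = φ a
  rw [← hθ, cfcHom_eq_of_isStarNormal]
  change ((e (e.symm (φ.codRestrict _ hφ a)) : StarAlgebra.elemental ℂ (π z)) : M) = φ a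
  rw [e.apply_symm_apply]
  rfl

theorem IsCStarProjective.realRankZero_awStar (A : Type*) [CommCStarAlgebra A] [Nontrivial A]
    [TopologicalSpace.SeparableSpace A] :
    IsCStarProjective HasRealRankZero IsAWStarAlgebra A := by
  intro B _ M _ hB hM π hπ φ
  rcases subsingleton_or_nontrivial M with hsub | hnon
  -- Over `M = 0` any unital map `A → B` is a lift; a character of `A` supplies one.
  · obtain ⟨χ⟩ : Nonempty (WeakDual.characterSpace ℂ A) := inferInstance
    let χ' : A →⋆ₐ[ℂ] ℂ := StarAlgHomClass.toStarAlgHom χ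
    exact ⟨(StarAlgHom.ofId ℂ B).comp χ', StarAlgHom.ext fun a => Subsingleton.elim _ _⟩
  obtain ⟨C, hφC, hC⟩ := φ.range.exists_isMaximalAbelian_ge (by
    rintro _ ⟨a, rfl⟩ _ ⟨b, rfl⟩
    exact (Commute.all a b).map φ)
  obtain ⟨T, hTP, hTc, hT⟩ := exists_countable_forall_mem_topologicalClosure_adjoin
    (map_continuous φ) (P := {p : M | p ∈ C ∧ IsStarProjection p}) fun a => by
      rw [hM.2 C hC]
      exact hφC ⟨a, rfl⟩
  -- Inserting `0` allows enumeration by `ℕ` even when `T` is empty.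
  obtain ⟨p, hp⟩ := (hTc.insert 0).exists_eq_range (insert_nonempty 0 T)
  have hpC : ∀ n, p n ∈ C ∧ IsStarProjection (p n) := fun n => by
    have : p n ∈ insert 0 T := hp ▸ mem_range_self n
    rcases this with h | h
    · exact h ▸ ⟨zero_mem C, .zero M⟩
    · exact hTP h
  let := hC.commCStarAlgebra
  obtain ⟨x, hx, hint, hpx⟩ := CommCStarAlgebra.exists_isSelfAdjoint_forall_mem_elemental
    (fun n => (⟨p n, (hpC n).1⟩ : C)) fun n =>
      ⟨Subtype.ext (hpC n).2.isIdempotentElem, Subtype.ext (hpC n).2.isSelfAdjoint⟩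
  have hxM : IsSelfAdjoint (x : M) := congrArg Subtype.val hx
  obtain ⟨z, hz, hzx, hspec⟩ := hB.exists_lift_spectrum_subset π hπ hxM
    (subset_eq_empty (interior_mono
      (AlgHom.spectrum_apply_subset (C.subtype.toAlgHom.restrictScalars ℝ) x)) hint)
  refine StarAlgHom.exists_lift_of_forall_mem_elemental π φ hz.isStarNormal ?_ fun a => ?_
  · rw [hzx]
    intro s hs
    have hre := (SpectrumRestricts.real_iff.1 hz.spectrumRestricts) s hs
    rw [hre] at hs ⊢
    have : s.re ∈ spectrum ℝ (x : M) := hspec (by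
      rwa [← spectrum.preimage_algebraMap ℂ])
    rwa [← spectrum.preimage_algebraMap ℂ] at this
  · refine StarSubalgebra.topologicalClosure_minimal (StarAlgebra.adjoin_le ?_)
      (StarAlgebra.elemental.isClosed ℂ (π z)) (hT a)
    intro q hq
    obtain ⟨n, rfl⟩ : q ∈ range p := hp ▸ mem_insert_of_mem 0 hq
    have hmap : (StarAlgebra.elemental ℂ x).map C.subtype ≤ StarAlgebra.elemental ℂ (π z) := by
      rw [StarAlgebra.elemental, StarAlgebra.elemental, hzx]
      refine (StarSubalgebra.map_topologicalClosure_le _ _ continuous_subtype_val).trans ?_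
      rw [StarAlgHom.map_adjoin, image_singleton]
      rfl
    exact hmap ⟨_, hpx n, rfl⟩

/-! ### Real rank zero of AW⋆-algebras -/

/-- Linear combinations of commuting projections have finite spectrum. -/
theorem IsMaximalAbelian.finite_spectrum_of_mem_adjoin_isStarProjection {M : Type*}
    [CStarAlgebra M] {C : StarSubalgebra ℂ M} (hC : IsMaximalAbelian C) {b : M}
    (hb : b ∈ StarAlgebra.adjoin ℂ {p : M | p ∈ C ∧ IsStarProjection p}) :
    (spectrum ℂ b).Finite := by
  let := hC.commCStarAlgebra
  have hle : StarAlgebra.adjoin ℂ {p : M | p ∈ C ∧ IsStarProjection p} ≤ C :=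
    StarAlgebra.adjoin_le fun p hp => hp.1
  -- Characters take only the values `0` and `1` on projections, and finiteness of the set of
  -- character values passes through the algebraic operations.
  have key : ∀ hb' : b ∈ C,
      (range fun χ : WeakDual.characterSpace ℂ C => χ ⟨b, hb'⟩).Finite := by
    induction hb using StarAlgebra.adjoin_induction with
    | mem p hp =>
      intro _
      refine (toFinite ({0, 1} : Set ℂ)).subset ?_
      rintro _ ⟨χ, rfl⟩
      exact IsIdempotentElem.eq_zero_or_one_apply
        (p := (⟨p, hp.1⟩ : C)) (Subtype.ext hp.2.isIdempotentElem) χ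
    | algebraMap r =>
      intro _
      refine (finite_singleton r).subset ?_
      rintro _ ⟨χ, rfl⟩
      exact AlgHomClass.commutes χ r
    | add x y hx hy ihx ihy =>
      intro _
      refine (Finite.image2 (· + ·) (ihx (hle hx)) (ihy (hle hy))).subset ?_
      rintro _ ⟨χ, rfl⟩
      exact ⟨_, ⟨χ, rfl⟩, _, ⟨χ, rfl⟩, (map_add χ ⟨x, hle hx⟩ ⟨y, hle hy⟩).symm⟩
    | mul x y hx hy ihx ihy =>
      intro _
      refine (Finite.image2 (· * ·) (ihx (hle hx)) (ihy (hle hy))).subset ?_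
      rintro _ ⟨χ, rfl⟩
      exact ⟨_, ⟨χ, rfl⟩, _, ⟨χ, rfl⟩, (map_mul χ ⟨x, hle hx⟩ ⟨y, hle hy⟩).symm⟩
    | star x hx ihx =>
      intro _
      refine ((ihx (hle hx)).image star).subset ?_
      rintro _ ⟨χ, rfl⟩
      exact ⟨_, ⟨χ, rfl⟩, (map_star χ ⟨x, hle hx⟩).symm⟩
  refine (key (hle hb)).subset fun z hz => ?_
  exact WeakDual.CharacterSpace.mem_spectrum_iff_exists.1
    (AlgHom.spectrum_apply_subset C.subtype.toAlgHom (⟨b, hle hb⟩ : C) hz)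

/-- AW⋆-algebras have real rank zero. -/
theorem IsAWStarAlgebra.hasRealRankZero {M : Type*} [CStarAlgebra M] (hM : IsAWStarAlgebra M) :
    HasRealRankZero M := by
  intro a ha ε hε
  have hcomm := StarAlgebra.isMulCommutative_adjoin ℂ (s := {a}) (by simp)
    (by simp [ha.star_eq])
  obtain ⟨C, haC, hC⟩ := (StarAlgebra.adjoin ℂ {a}).exists_isMaximalAbelian_ge
    fun x hx y hy => setLike_mul_comm hx hy
  have ha' : a ∈
      (StarAlgebra.adjoin ℂ {p : M | p ∈ C ∧ IsStarProjection p}).topologicalClosure := by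
    rw [hM.2 C hC]
    exact haC (StarAlgebra.self_mem_adjoin_singleton ℂ a)
  obtain ⟨b, hb, hab⟩ := Metric.mem_closure_iff.1 ha' ε hε
  have hb2 : ((2 : ℂ)⁻¹ • (b + star b)) ∈
      StarAlgebra.adjoin ℂ {p : M | p ∈ C ∧ IsStarProjection p} :=
    SMulMemClass.smul_mem _ (add_mem hb (star_mem hb))
  refine ⟨_, ?_, hC.finite_spectrum_of_mem_adjoin_isStarProjection hb2, ?_⟩
  · simp [IsSelfAdjoint, add_comm]
  · have h : a - (2 : ℂ)⁻¹ • (b + star b) = (2 : ℂ)⁻¹ • ((a - b) + star (a - b)) := by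
      rw [star_sub, ha.star_eq]
      module
    rw [dist_eq_norm] at hab
    have := norm_add_le (a - b) (star (a - b))
    rw [norm_star] at this
    rw [h, norm_smul, norm_inv, RCLike.norm_ofNat]
    linarith

/-! ### Von Neumann algebras are AW⋆-algebras -/

/-- A commutative C⋆-algebra in which orthogonal elements are separated by projections is
generated by its projections. -/
theorem CommCStarAlgebra.topologicalClosure_adjoin_isStarProjection {N : Type*}
    [CommCStarAlgebra N]
    (hN : ∀ h k : N, k * h = 0 → ∃ e : N, IsStarProjection e ∧ e * h = h ∧ k * e = 0) :
    (StarAlgebra.adjoin ℂ {p : N | IsStarProjection p}).topologicalClosure = ⊤ := by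
  let X := WeakDual.characterSpace ℂ N
  let G := gelfandStarTransform N
  have hbump : ∀ (χ : X) (U : Set X), IsOpen U → χ ∈ U →
      ∃ f : C(X, ℂ), f χ = 1 ∧ ∀ ξ ∉ U, f ξ = 0 := by
    intro χ U hU hχ
    obtain ⟨f, hf0, hf1, -⟩ := exists_continuous_zero_one_of_isClosed hU.isClosed_compl
      isClosed_singleton (disjoint_singleton_right.2 (not_not.2 hχ))
    exact ⟨⟨fun ξ => (f ξ : ℂ), by fun_prop⟩, by simp [hf1 rfl], fun ξ hξ => by simp [hf0 hξ]⟩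
  -- For Stone–Weierstrass: disjoint bump functions at two characters are orthogonal, and the
  -- projection between them takes the values `1` and `0`.
  have hsep : ((StarAlgebra.adjoin ℂ {p : N | IsStarProjection p}).map
      (G : N →⋆ₐ[ℂ] C(X, ℂ))).SeparatesPoints := by
    intro χ₁ χ₂ hne
    obtain ⟨U, V, hU, hV, h1, h2, hUV⟩ := t2_separation hne
    obtain ⟨f, hf1, hf0⟩ := hbump χ₁ U hU h1
    obtain ⟨g, hg1, hg0⟩ := hbump χ₂ V hV h2
    have hgf : g * f = 0 := by
      ext ξ
      by_cases hξ : ξ ∈ U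
      · simp [hg0 ξ (hUV.notMem_of_mem_left hξ)]
      · simp [hf0 ξ hξ]
    obtain ⟨e, he, heh, hke⟩ := hN (G.symm f) (G.symm g) (by rw [← map_mul, hgf, map_zero])
    have heh' : G e * f = f := by
      simpa using congrArg G heh
    have hke' : g * G e = 0 := by
      simpa using congrArg G hke
    refine ⟨G e, ⟨G e, ⟨e, StarAlgebra.subset_adjoin ℂ _ he, rfl⟩, rfl⟩, ?_⟩
    have e1 : G e χ₁ = 1 := by simpa [hf1] using DFunLike.congr_fun heh' χ₁
    have e2 : G e χ₂ = 0 := by simpa [hg1] using DFunLike.congr_fun hke' χ₂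
    rw [e1, e2]
    exact one_ne_zero
  have htop := ContinuousMap.starSubalgebra_topologicalClosure_eq_top_of_separatesPoints _ hsep
  refine StarSubalgebra.eq_top_iff.2 fun a => ?_
  have ha : G a ∈ closure (G '' (StarAlgebra.adjoin ℂ {p : N | IsStarProjection p} : Set N)) :=
    StarSubalgebra.eq_top_iff.1 htop (G a)
  have := map_mem_closure (map_continuous (G.symm : C(X, ℂ) →⋆ₐ[ℂ] N)) ha
    (t := (StarAlgebra.adjoin ℂ {p : N | IsStarProjection p} : Set N)) (by
      rintro _ ⟨b, hb, rfl⟩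
      change G.symm (G b) ∈ _
      rwa [G.symm_apply_apply])
  change G.symm (G a) ∈ _ at this
  rwa [G.symm_apply_apply] at this

theorem ContinuousLinearMap.mapsTo_topologicalClosure {H : Type*} [NormedAddCommGroup H]
    [InnerProductSpace ℂ H] {c : H →L[ℂ] H} {U : Submodule ℂ H}
    (hc : ∀ v ∈ U, c v ∈ U) : ∀ v ∈ U.topologicalClosure, c v ∈ U.topologicalClosure :=
  fun _ hv => map_mem_closure c.continuous hv hc

section VonNeumann

variable {H : Type*} [NormedAddCommGroup H] [InnerProductSpace ℂ H] [CompleteSpace H]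

theorem Submodule.starProjection_commute_of_mapsTo {U : Submodule ℂ H} [U.HasOrthogonalProjection]
    {c : H →L[ℂ] H} (hc : ∀ v ∈ U, c v ∈ U) (hc' : ∀ v ∈ U, star c v ∈ U) :
    Commute c U.starProjection := by
  have key : ∀ d : H →L[ℂ] H, (∀ v ∈ U, d v ∈ U) →
      U.starProjection * (d * U.starProjection) = d * U.starProjection := fun d hd => by
    ext v
    exact Submodule.starProjection_eq_self_iff.2 (hd _ (U.starProjection_apply_mem v))
  have hsa : star U.starProjection = U.starProjection := isSelfAdjoint_starProjection U
  have h := congrArg star (key _ hc')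
  rw [star_mul, star_mul, star_star, hsa, mul_assoc, key c hc] at h
  exact h

theorem VonNeumannAlgebra.starProjection_mem (S : VonNeumannAlgebra H) {U : Submodule ℂ H}
    [U.HasOrthogonalProjection] (hU : ∀ T ∈ S.commutant, ∀ v ∈ U, T v ∈ U) :
    U.starProjection ∈ S := by
  rw [VonNeumannAlgebra.IsStarProjection.mem_iff isStarProjection_starProjection]
  intro T hT v hv
  rw [Submodule.range_starProjection] at hv ⊢
  exact hU T hT v hv

end VonNeumann

variable {M : Type u} [CStarAlgebra M]

/-- In a von Neumann algebra, every set of projections has a least upper bound. -/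
theorem IsVonNeumannAlgebra.exists_isProjectionLUB (hM : IsVonNeumannAlgebra M) (S : Set M)
    (hS : ∀ p ∈ S, IsStarProjection p) : ∃ q : M, IsProjectionLUB S q := by
  obtain ⟨H, _, _, _, R, ⟨ι⟩⟩ := hM
  let j : M →⋆ₐ[ℂ] (H →L[ℂ] H) := R.toStarSubalgebra.subtype.comp (ι : M →⋆ₐ[ℂ] _)
  have hj : Function.Injective j := Subtype.val_injective.comp ι.injective
  -- The join projects onto the closed span of the ranges; the commutant preserves this space, so
  -- the projection lies in `R`.
  let U₀ : Submodule ℂ H := ⨆ p : S, (j p).range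
  let U := U₀.topologicalClosure
  have : CompleteSpace U := U₀.isClosed_topologicalClosure.completeSpace_coe
  have hinv : ∀ T ∈ R.commutant, ∀ v ∈ U, T v ∈ U := by
    intro T hT
    refine ContinuousLinearMap.mapsTo_topologicalClosure fun v hv => ?_
    have : U₀ ≤ U₀.comap (T : H →ₗ[ℂ] H) := by
      refine iSup_le fun p => ?_
      rintro _ ⟨w, rfl⟩
      have hcomm := VonNeumannAlgebra.mem_commutant_iff.1 hT (j p) (ι p).2
      refine Submodule.mem_iSup_of_mem p ⟨T w, ?_⟩
      exact DFunLike.congr_fun hcomm w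
    exact this hv
  let q : M := ι.symm ⟨U.starProjection, R.starProjection_mem hinv⟩
  have hjq : j q = U.starProjection := congrArg Subtype.val (ι.apply_symm_apply _)
  have hq : IsStarProjection q :=
    ⟨hj (by rw [map_mul, hjq]; exact U.isIdempotentElem_starProjection),
      hj (by rw [map_star, hjq]; exact isSelfAdjoint_starProjection U)⟩
  refine ⟨q, hq, fun p hp => ?_, fun r hr hpr => ?_⟩
  · have h : q * p = p := by
      apply hj
      rw [map_mul, hjq]
      ext v
      exact Submodule.starProjection_eq_self_iff.2 (U₀.le_topologicalClosure
        (Submodule.mem_iSup_of_mem (⟨p, hp⟩ : S) ⟨v, rfl⟩))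
    simpa [hq.isSelfAdjoint.star_eq, (hS p hp).isSelfAdjoint.star_eq] using congrArg star h
  · have hle : U ≤ ((j r : H →ₗ[ℂ] H) - 1).ker := by
      refine U₀.topologicalClosure_minimal (iSup_le fun p => ?_)
        (ContinuousLinearMap.isClosed_ker (j r - 1))
      rintro _ ⟨w, rfl⟩
      have h : r * p = p := by
        simpa [hr.isSelfAdjoint.star_eq, (hS p p.2).isSelfAdjoint.star_eq] using
          congrArg star (hpr p p.2)
      have := DFunLike.congr_fun (congrArg j h) w
      rw [map_mul] at this
      exact sub_eq_zero.2 this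
    have h : r * q = q := by
      apply hj
      rw [map_mul, hjq]
      ext v
      exact sub_eq_zero.1 (hle (U.starProjection_apply_mem v))
    simpa [hq.isSelfAdjoint.star_eq, hr.isSelfAdjoint.star_eq] using congrArg star h

/-- Range projections in von Neumann algebras. -/
theorem IsVonNeumannAlgebra.exists_range_projection (hM : IsVonNeumannAlgebra M) (h : M) :
    ∃ e : M, IsStarProjection e ∧ e * h = h ∧ (∀ k, k * h = 0 → k * e = 0) ∧
      ∀ c, Commute c h → Commute (star c) h → Commute c e := by
  obtain ⟨H, _, _, _, R, ⟨ι⟩⟩ := hM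
  let j : M →⋆ₐ[ℂ] (H →L[ℂ] H) := R.toStarSubalgebra.subtype.comp (ι : M →⋆ₐ[ℂ] _)
  have hj : Function.Injective j := Subtype.val_injective.comp ι.injective
  let U₀ : Submodule ℂ H := (j h).range
  let U := U₀.topologicalClosure
  have : CompleteSpace U := U₀.isClosed_topologicalClosure.completeSpace_coe
  have hcommute : ∀ T : H →L[ℂ] H, Commute (j h) T → ∀ v ∈ U, T v ∈ U := by
    intro T hT
    refine ContinuousLinearMap.mapsTo_topologicalClosure ?_
    rintro _ ⟨w, rfl⟩
    exact ⟨T w, DFunLike.congr_fun hT.eq w⟩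
  have hinv : ∀ T ∈ R.commutant, ∀ v ∈ U, T v ∈ U := fun T hT =>
    hcommute T (VonNeumannAlgebra.mem_commutant_iff.1 hT (j h) (ι h).2)
  let e : M := ι.symm ⟨U.starProjection, R.starProjection_mem hinv⟩
  have hje : j e = U.starProjection := congrArg Subtype.val (ι.apply_symm_apply _)
  refine ⟨e, ⟨hj (by rw [map_mul, hje]; exact U.isIdempotentElem_starProjection),
      hj (by rw [map_star, hje]; exact isSelfAdjoint_starProjection U)⟩, ?_, ?_, ?_⟩
  · apply hj
    rw [map_mul, hje]
    ext v
    exact Submodule.starProjection_eq_self_iff.2 (U₀.le_topologicalClosure ⟨v, rfl⟩)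
  · intro k hk
    have hle : U ≤ (j k).ker := by
      refine U₀.topologicalClosure_minimal ?_ (ContinuousLinearMap.isClosed_ker (j k))
      rintro _ ⟨w, rfl⟩
      have := DFunLike.congr_fun (congrArg j hk) w
      rw [map_mul, map_zero] at this
      exact this
    apply hj
    rw [map_mul, hje, map_zero]
    ext v
    exact hle (U.starProjection_apply_mem v)
  · intro c hc hc'
    have hcj := Submodule.starProjection_commute_of_mapsTo (U := U) (c := j c)
      (hcommute _ (hc.symm.map j)) (by rw [← map_star]; exact hcommute _ (hc'.symm.map j))
    refine hj ?_
    rw [map_mul, map_mul, hje]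
    exact hcj

/-- Von Neumann algebras are AW⋆-algebras. -/
theorem IsVonNeumannAlgebra.isAWStarAlgebra (hM : IsVonNeumannAlgebra M) : IsAWStarAlgebra M := by
  refine ⟨hM.exists_isProjectionLUB, fun C hC => le_antisymm ?_ fun x hx => ?_⟩
  · exact StarSubalgebra.topologicalClosure_minimal
      (StarAlgebra.adjoin_le fun p hp => hp.1) hC.isClosed
  let := hC.commCStarAlgebra
  have htop := CommCStarAlgebra.topologicalClosure_adjoin_isStarProjection (N := C) (by
    intro h k hkh
    obtain ⟨e, he, heh, hke, hcomm⟩ := hM.exists_range_projection (h : M)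
    -- The range projection of `h` commutes with all of `C`, so maximality puts it in `C`.
    have heC : e ∈ C := hC.mem_of_commute he.isSelfAdjoint fun c hc =>
      hcomm c (hC.1 c hc h h.2) (hC.1 _ (star_mem hc) h h.2)
    exact ⟨⟨e, heC⟩, ⟨Subtype.ext he.isIdempotentElem, Subtype.ext he.isSelfAdjoint⟩,
      Subtype.ext heh, Subtype.ext (hke k (congrArg Subtype.val hkh))⟩)
  refine map_mem_closure continuous_subtype_val (StarSubalgebra.eq_top_iff.1 htop ⟨x, hx⟩)
    fun b hb => ?_
  have hmap : (StarAlgebra.adjoin ℂ {p : C | IsStarProjection p}).map C.subtype ≤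
      StarAlgebra.adjoin ℂ {p : M | p ∈ C ∧ IsStarProjection p} := by
    rw [StarAlgHom.map_adjoin]
    refine StarAlgebra.adjoin_mono ?_
    rintro _ ⟨p, hp, rfl⟩
    exact ⟨p.2, hp.map C.subtype⟩
  exact hmap ⟨b, hb, rfl⟩

theorem theorem5p1 (A : Type u) [CommCStarAlgebra A] [Nontrivial A]
    [TopologicalSpace.SeparableSpace A] :
    IsCStarProjective.{u, v, w} HasRealRankZero.{v} IsAWStarAlgebra.{w} A ∧
      IsCStarProjective.{u, v, w} IsVonNeumannAlgebra.{v} IsVonNeumannAlgebra.{w} A :=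
  ⟨IsCStarProjective.realRankZero_awStar A, fun B _ M _ hB hM =>
    IsCStarProjective.realRankZero_awStar A B M hB.isAWStarAlgebra.hasRealRankZero
      hM.isAWStarAlgebra⟩
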